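/- Let $f:\mathbb{C}[x,y,z]\to\mathbb{C}[x,y,z]$ be a $\mathbb{C}$-algebra endomorphism, and put $p=f(x)$, $q=f(y)$, $r=f(z)$. Suppose that the Jacobian determinant $\operatorname{Jac}(p,q,r)=\det\frac{\partial(p,q,r)}{\partial(x,y,z)}$ is a nonzero constant, i.e. an element of $\mathbb{C}^*$. Then there exist a nonzero $u\in\mathbb{C}[p,q,r,x,y]$ and a nonzero $v\in\mathbb{C}[p,q,r]$ such that $z=u/v$ in the field of fractions $\mathbb{C}(x,y,z)$. Here $\mathbb{C}[p,q,r,x,y]$ and $\mathbb{C}[p,q,r]$ denote the $\mathbb{C}$-subalgebras of $\mathbb{C}[x,y,z]$ generated by the listed elements. -/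

import Mathlib

/-- The Jacobian matrix `(∂ f(xᵢ) / ∂ xⱼ)` of an endomorphism `f` of `ℂ[x₀, …, xₙ₋₁]`. -/
noncomputable def polyJacobianMatrix {n : ℕ}
    (f : MvPolynomial (Fin n) ℂ →ₐ[ℂ] MvPolynomial (Fin n) ℂ) :
    Matrix (Fin n) (Fin n) (MvPolynomial (Fin n) ℂ) :=
  Matrix.of fun i j => MvPolynomial.pderiv j (f (MvPolynomial.X i))

/-- `f` is a Jacobian endomorphism: its Jacobian determinant is a nonzero constant. -/
def IsJacobianEndomorphism {n : ℕ}
    (f : MvPolynomial (Fin n) ℂ →ₐ[ℂ] MvPolynomial (Fin n) ℂ) : Prop :=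
  ∃ c : ℂ, c ≠ 0 ∧ (polyJacobianMatrix f).det = MvPolynomial.C c

/-! ### Lüroth's theorem with a polynomial generator. -/

section PolynomialLuroth

open Polynomial IntermediateField

variable {F : Type*} [Field F]

/-! View `p, q, r` as polynomials in `z` over `K = ℂ(x, y)`. Expanding the Jacobian along its
`z`-column, any common divisor of their `z`-derivatives in `K[z]` divides a nonzero constant. By
Lüroth, `K(p, q, r) = K(g)`, and `g` can be chosen in `K[z]`; then each of `p, q, r` is a polynomial
in `g`, so `g'` divides all three derivatives and is a unit. In characteristic zero `g` is linear,
whence `ℂ(p, q, r, x, y) = ℂ(x, y, z)` (`adjoin_toRatFunc_eq_top`).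

The nonzero Jacobian also makes `p, q, r` a transcendence basis, so `x, y` are algebraic over `ℂ(p,
q, r)`. Hence the field is `ℂ(p, q, r)[x, y]`, and only denominators from `ℂ[p, q, r]` are needed.
-/

lemma exists_adjoin_simple_eq_one_lt_inftyValuation [DecidableEq (RatFunc F)] (a : RatFunc F)
    (ha : ¬ ∃ c, a = RatFunc.C c) :
    ∃ b : RatFunc F, F⟮b⟯ = F⟮a⟯ ∧ 1 < RatFunc.inftyValuation F b := by
  set v := RatFunc.inftyValuation F with hv
  have inv_case : ∀ b : RatFunc F, b ≠ 0 → F⟮b⟯ = F⟮a⟯ → v b < 1 →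
      ∃ b : RatFunc F, F⟮b⟯ = F⟮a⟯ ∧ 1 < v b := by
    intro b hb h hlt
    refine ⟨b⁻¹, ?_, ?_⟩
    · rw [← h]
      apply le_antisymm <;> rw [adjoin_simple_le_iff]
      · exact inv_mem (mem_adjoin_simple_self F b)
      · simpa using inv_mem (mem_adjoin_simple_self F b⁻¹)
    · rw [map_inv₀]
      exact (one_lt_inv₀ (by simpa [zero_lt_iff] using hb)).2 hlt
  have ha0 : a ≠ 0 := fun h => ha ⟨0, by simp [h]⟩
  rcases lt_trichotomy (v a) 1 with h | h | h
  · exact inv_case a ha0 rfl h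
  -- Subtracting the value `c` of `a` at infinity leaves a zero there; inverting gives a pole.
  · set c := a.num.leadingCoeff / a.denom.leadingCoeff with hc
    have hn0 : a.num ≠ 0 := RatFunc.num_ne_zero ha0
    have hd0 : a.denom ≠ 0 := a.denom_ne_zero
    have hdeg : a.num.natDegree = a.denom.natDegree := by
      rw [hv, RatFunc.inftyValuation_apply, RatFunc.inftyValuation_of_nonzero F ha0] at h
      have : a.intDegree = 0 := by simpa using h
      rw [RatFunc.intDegree] at this
      omega
    have hc0 : c ≠ 0 := div_ne_zero (by simpa) (by simpa)
    have hsub : a - RatFunc.C c ≠ 0 := fun h => ha ⟨c, sub_eq_zero.1 h⟩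
    apply inv_case (a - RatFunc.C c) hsub
    · apply le_antisymm <;> rw [adjoin_simple_le_iff]
      · exact sub_mem (mem_adjoin_simple_self F a) (F⟮a⟯.algebraMap_mem c)
      · have := add_mem (mem_adjoin_simple_self F (a - RatFunc.C c))
          (F⟮a - RatFunc.C c⟯.algebraMap_mem c)
        rwa [show algebraMap F (RatFunc F) c = RatFunc.C c from rfl, sub_add_cancel] at this
    · have hd0' : algebraMap F[X] (RatFunc F) a.denom ≠ 0 := RatFunc.algebraMap_ne_zero hd0
      have key : a - RatFunc.C c =
          algebraMap F[X] (RatFunc F) (a.num - Polynomial.C c * a.denom) /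
            algebraMap F[X] (RatFunc F) a.denom := by
        conv_lhs => rw [← RatFunc.num_div_denom a]
        rw [map_sub, map_mul, RatFunc.algebraMap_C]
        field_simp
      have hn1 : a.num - Polynomial.C c * a.denom ≠ 0 := by
        intro h0
        rw [key, h0] at hsub
        simp at hsub
      have hlt : (a.num - Polynomial.C c * a.denom).natDegree < a.denom.natDegree := by
        rw [← hdeg]
        apply natDegree_lt_natDegree hn1
        apply degree_sub_lt_left _ hn0
        · rw [leadingCoeff_mul, leadingCoeff_C, hc, div_mul_cancel₀ _ (by simpa)]
        · rw [degree_C_mul hc0, degree_eq_natDegree hn0, degree_eq_natDegree hd0, hdeg]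
      rw [hv, RatFunc.inftyValuation_apply, RatFunc.inftyValuation_of_nonzero F hsub, key,
        RatFunc.intDegree_div (RatFunc.algebraMap_ne_zero hn1) hd0', RatFunc.intDegree_polynomial,
        RatFunc.intDegree_polynomial, ← WithZero.exp_zero, WithZero.exp_lt_exp]
      omega
  · exact ⟨a, rfl, h⟩

lemma exists_isCoprime_mul_aeval_eq {a x : RatFunc F} (ha : Transcendental F a) (hx : x ∈ F⟮a⟯) :
    ∃ P Q : F[X], Q.Monic ∧ IsCoprime P Q ∧ x * aeval a Q = aeval a P := by
  obtain ⟨r, s, rfl⟩ := (mem_adjoin_simple_iff F x).1 hx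
  by_cases hs : s = 0
  · exact ⟨0, 1, monic_one, isCoprime_one_right, by simp [hs]⟩
  set R : RatFunc F := algebraMap F[X] _ r / algebraMap F[X] _ s with hR
  refine ⟨R.num, R.denom, R.monic_denom, R.isCoprime_num_denom, ?_⟩
  have hs' : aeval a s ≠ 0 := fun h => ha ⟨s, hs, h⟩
  have h : r * R.denom = R.num * s := by
    apply RatFunc.algebraMap_injective F
    have h1 := RatFunc.num_div_denom R
    rw [hR, div_eq_div_iff (RatFunc.algebraMap_ne_zero R.denom_ne_zero)
      (RatFunc.algebraMap_ne_zero hs)] at h1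
    rw [map_mul, map_mul, ← hR] at *
    exact h1.symm
  have h2 := congrArg (aeval a) h
  rw [map_mul, map_mul] at h2
  rw [div_mul_eq_mul_div, h2, mul_div_cancel_right₀ _ hs']

/-- A generator `b` with a pole at infinity satisfies `P(b) = p Q(b)`. Valuations at infinity force
`deg Q < deg P`, so `b` is integral over `F[X]`, hence a polynomial. -/
lemma exists_polynomial_adjoin_simple_eq {a : RatFunc F} {p : F[X]} (hp : p.natDegree ≠ 0)
    (hpa : algebraMap F[X] (RatFunc F) p ∈ F⟮a⟯) :
    ∃ g : F[X], F⟮algebraMap F[X] (RatFunc F) g⟯ = F⟮a⟯ := by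
  classical
  have hp0 : p ≠ 0 := by rintro rfl; simp at hp
  have ha : ¬ ∃ c, a = RatFunc.C c := by
    rintro ⟨c, rfl⟩
    have : F⟮(RatFunc.C c : RatFunc F)⟯ = ⊥ := by
      rw [adjoin_simple_eq_bot_iff]
      exact ⟨c, rfl⟩
    rw [this] at hpa
    obtain ⟨d, hd⟩ := hpa
    apply hp
    have : Polynomial.C d = p := by
      apply RatFunc.algebraMap_injective F
      rw [RatFunc.algebraMap_C]
      exact hd
    rw [← this, natDegree_C]
  obtain ⟨b, hb, hvb⟩ := exists_adjoin_simple_eq_one_lt_inftyValuation a ha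
  rw [← hb] at hpa ⊢
  have hbt : Transcendental F b := by
    apply RatFunc.transcendental_of_ne_C
    rintro ⟨c, rfl⟩
    by_cases hc : c = 0
    · simp [hc] at hvb
    · have : RatFunc.inftyValuation F (RatFunc.C c) = 1 := RatFunc.inftyValuation.C F hc
      exact absurd hvb (by rw [this]; exact lt_irrefl _)
  -- Using `p⁻¹` makes `P`, the numerator of `p`, the monic one.
  obtain ⟨Q, P, hP, -, h⟩ := exists_isCoprime_mul_aeval_eq hbt (inv_mem hpa)
  have hp0' : algebraMap F[X] (RatFunc F) p ≠ 0 := RatFunc.algebraMap_ne_zero hp0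
  rw [inv_mul_eq_iff_eq_mul₀ hp0'] at h
  have hPb : aeval b P ≠ 0 := fun h' => hbt ⟨P, hP.ne_zero, h'⟩
  have hQ : Q ≠ 0 := by
    rintro rfl
    rw [map_zero, mul_zero] at h
    exact hPb h
  have hdeg : Q.natDegree < P.natDegree := by
    have h1 := congrArg (RatFunc.inftyValuation F) h
    have hv1 : 1 < RatFunc.inftyValuation F (algebraMap F[X] (RatFunc F) p) := by
      rw [RatFunc.inftyValuation_apply, RatFunc.inftyValuation_of_nonzero F hp0', RatFunc.intDegree_polynomial, ← WithZero.exp_zero,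
        WithZero.exp_lt_exp]
      omega
    rw [map_mul,
      valuation_aeval_eq_valuation_X_pow_natDegree_of_one_lt_valuation_X b hvb hP.ne_zero,
      valuation_aeval_eq_valuation_X_pow_natDegree_of_one_lt_valuation_X b hvb hQ] at h1
    by_contra hle
    push Not at hle
    have h2 := pow_le_pow_right₀ hvb.le hle
    rw [h1] at h2
    have h3 : 0 < RatFunc.inftyValuation F b ^ Q.natDegree := pow_pos (zero_lt_one.trans hvb) _
    exact absurd h2 (not_le.2 (lt_mul_of_one_lt_left h3 hv1))
  have hint : IsIntegral F[X] b := by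
    refine ⟨P.map Polynomial.C - Polynomial.C p * Q.map Polynomial.C, ?_, ?_⟩
    · apply (hP.map _).sub_of_left
      rw [degree_C_mul hp0, degree_map, degree_map]
      exact degree_lt_degree hdeg
    · have hcomp : (algebraMap F[X] (RatFunc F)).comp Polynomial.C = algebraMap F (RatFunc F) := by
        ext; simp
      rw [eval₂_sub, eval₂_mul, eval₂_C, eval₂_map, eval₂_map, hcomp, ← aeval_def, ← aeval_def, h,
        sub_self]
  obtain ⟨g, hg⟩ := IsIntegrallyClosed.isIntegral_iff.1 hint
  exact ⟨g, by rw [hg]⟩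

/-- Composing a Bézout relation with `g` shows that the denominator `Q(g)` divides `1`. -/
lemma exists_eq_comp_of_mem_adjoin_simple {g p : F[X]} (hg : g.natDegree ≠ 0)
    (hp : algebraMap F[X] (RatFunc F) p ∈ F⟮algebraMap F[X] (RatFunc F) g⟯) :
    ∃ P : F[X], p = P.comp g := by
  have hgt : Transcendental F (algebraMap F[X] (RatFunc F) g) := by
    apply RatFunc.transcendental_of_ne_C
    rintro ⟨c, hc⟩
    rw [← RatFunc.algebraMap_C] at hc
    rw [RatFunc.algebraMap_injective F hc, natDegree_C] at hg
    exact hg rfl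
  obtain ⟨P, Q, -, ⟨u, w, huw⟩, h⟩ := exists_isCoprime_mul_aeval_eq hgt hp
  rw [aeval_algebraMap_apply, aeval_algebraMap_apply, ← map_mul] at h
  replace h := RatFunc.algebraMap_injective F h
  rw [← comp_eq_aeval, ← comp_eq_aeval] at h
  have h1 := congrArg (fun t => t.comp g) huw
  simp only [add_comp, mul_comp, one_comp] at h1
  have hu : IsUnit (Q.comp g) := by
    apply IsUnit.of_mul_eq_one (u.comp g * p + w.comp g)
    rw [← h1, ← h]; ring
  obtain ⟨c, hc, hcQ⟩ := Polynomial.isUnit_iff.1 hu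
  refine ⟨Polynomial.C c⁻¹ * P, ?_⟩
  rw [mul_comp, C_comp, ← h, ← hcQ, mul_left_comm, ← Polynomial.C_mul,
    inv_mul_cancel₀ hc.ne_zero, Polynomial.C_1, mul_one]

/-- A family of polynomials over a field of characteristic zero whose derivatives have no
common nonunit divisor generates the field of rational functions. -/
theorem adjoin_image_algebraMap_eq_top_of_derivative [CharZero F] (S : Set F[X])
    (hS : ∀ d : F[X], (∀ p ∈ S, d ∣ derivative p) → IsUnit d) :
    IntermediateField.adjoin F (algebraMap F[X] (RatFunc F) '' S) = ⊤ := by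
  obtain ⟨p, hpS, hp⟩ : ∃ p ∈ S, p.natDegree ≠ 0 := by
    by_contra! h
    refine not_isUnit_zero (hS 0 fun p hp => ?_)
    rw [derivative_of_natDegree_zero (h p hp)]
  set E := IntermediateField.adjoin F (algebraMap F[X] (RatFunc F) '' S) with hE
  have hmem : ∀ p ∈ S, algebraMap F[X] (RatFunc F) p ∈ E := fun p hp =>
    subset_adjoin F _ ⟨p, hp, rfl⟩
  obtain ⟨g, hg⟩ : ∃ g : F[X], F⟮algebraMap F[X] (RatFunc F) g⟯ = E := by
    rw [RatFunc.Luroth.eq_adjoin_generator (E := E)]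
    apply exists_polynomial_adjoin_simple_eq hp
    rw [← RatFunc.Luroth.eq_adjoin_generator (E := E)]
    exact hmem p hpS
  have hg0 : g.natDegree ≠ 0 := by
    intro h0
    obtain ⟨c, rfl⟩ := natDegree_eq_zero.1 h0
    have h1 : F⟮algebraMap F[X] (RatFunc F) (Polynomial.C c)⟯ = ⊥ := by
      rw [adjoin_simple_eq_bot_iff, RatFunc.algebraMap_C]
      exact ⟨c, rfl⟩
    have h2 := hmem p hpS
    rw [← hg, h1] at h2
    obtain ⟨d, hd⟩ := h2
    apply hp
    rw [← RatFunc.algebraMap_injective F ((RatFunc.algebraMap_C d).trans hd), natDegree_C]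
  have hu : IsUnit (derivative g) := by
    apply hS
    intro q hq
    obtain ⟨P, rfl⟩ := exists_eq_comp_of_mem_adjoin_simple hg0 (hg ▸ hmem q hq)
    rw [derivative_comp]
    exact dvd_mul_right _ _
  have hdeg : g.natDegree = 1 := by
    have := natDegree_eq_zero_of_isUnit hu
    rw [natDegree_derivative] at this
    omega
  rw [← hg, eq_top_iff, ← RatFunc.adjoin_X, adjoin_simple_le_iff]
  have h1 := eq_X_add_C_of_natDegree_le_one hdeg.le
  have hc : g.coeff 1 ≠ 0 := by
    rw [← hdeg, coeff_natDegree, leadingCoeff_ne_zero]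
    rintro rfl; simp at hg0
  have h2 : (RatFunc.X : RatFunc F) = (algebraMap F (RatFunc F) (g.coeff 1))⁻¹ *
      (algebraMap F[X] (RatFunc F) g - algebraMap F (RatFunc F) (g.coeff 0)) := by
    have h3 : algebraMap F (RatFunc F) (g.coeff 1) ≠ 0 := by simpa using hc
    rw [eq_inv_mul_iff_mul_eq₀ h3]
    conv_rhs => enter [1]; rw [h1]
    rw [map_add, map_mul, RatFunc.algebraMap_C, RatFunc.algebraMap_C, RatFunc.algebraMap_X]
    change _ = algebraMap F (RatFunc F) (g.coeff 1) * RatFunc.X +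
      algebraMap F (RatFunc F) (g.coeff 0) - algebraMap F (RatFunc F) (g.coeff 0)
    rw [add_sub_cancel_right]
  rw [h2]
  exact mul_mem (inv_mem (IntermediateField.algebraMap_mem _ _))
    (sub_mem (mem_adjoin_simple_self F _) (IntermediateField.algebraMap_mem _ _))

end PolynomialLuroth

/-! ### Partial derivatives and the chain rule. -/

namespace MvPolynomial

lemma totalDegree_pderiv_lt {σ R : Type*} [CommSemiring R] (i : σ) (P : MvPolynomial σ R)
    (h : pderiv i P ≠ 0) : (pderiv i P).totalDegree < P.totalDegree := by
  have hpos : ∀ m ∈ (pderiv i P).support, m.degree < P.totalDegree := by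
    intro m hm
    rw [mem_support_iff, coeff_pderiv] at hm
    have h1 : m + Finsupp.single i 1 ∈ P.support :=
      mem_support_iff.2 fun h0 => hm (by rw [h0, zero_mul])
    have h2 := le_totalDegree h1
    change (m + Finsupp.single i 1).degree ≤ _ at h2
    rw [map_add, Finsupp.degree_single] at h2
    omega
  obtain ⟨m, hm⟩ := support_nonempty.2 h
  rw [totalDegree, Finset.sup_lt_iff (lt_of_le_of_lt bot_le (hpos m hm))]
  exact hpos

lemma eq_C_of_pderiv_eq_zero {σ R : Type*} [CommRing R] [IsDomain R] [CharZero R]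
    {P : MvPolynomial σ R} (h : ∀ i, pderiv i P = 0) : P = C (coeff 0 P) := by
  classical
  ext m
  rw [coeff_C]
  split_ifs with hm
  · rw [hm]
  · obtain ⟨i, hi⟩ : ∃ i, m i ≠ 0 := by
      by_contra! h0
      exact hm (Finsupp.ext h0).symm
    have h1 := coeff_pderiv (i := i) P (m - Finsupp.single i 1)
    rw [h i, coeff_zero, tsub_add_cancel_of_le (Finsupp.single_le_iff.2 (by omega))] at h1
    exact (mul_eq_zero.1 h1.symm).resolve_right (Nat.cast_add_one_ne_zero _)

lemma pderiv_algHom_apply {σ τ R : Type*} [Fintype σ] [CommRing R]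
    (f : MvPolynomial σ R →ₐ[R] MvPolynomial τ R) (j : τ) (P : MvPolynomial σ R) :
    pderiv j (f P) = ∑ i, f (pderiv i P) * pderiv j (f (X i)) := by
  classical
  induction P using MvPolynomial.induction_on with
  | C a =>
    rw [← algebraMap_eq, f.commutes, algebraMap_eq, algebraMap_eq]
    simp
  | add p q hp hq => simp [hp, hq, add_mul, Finset.sum_add_distrib]
  | mul_X p i hp =>
    simp only [map_mul, Derivation.leibniz, smul_eq_mul, hp, map_add, add_mul,
      Finset.sum_add_distrib, pderiv_X]
    congr 1
    · simp [Pi.single_apply, apply_ite f]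
    · rw [Finset.mul_sum]
      exact Finset.sum_congr rfl fun _ _ => by ring

end MvPolynomial

/-! ### Jacobian criterion for algebraic independence. -/

section Jacobian

open MvPolynomial

/-- By the chain rule the partials of a relation are again relations, of smaller degree, so by
induction they vanish and the relation is constant. -/
lemma injective_of_det_polyJacobianMatrix_ne_zero {n : ℕ}
    {f : MvPolynomial (Fin n) ℂ →ₐ[ℂ] MvPolynomial (Fin n) ℂ}
    (hf : (polyJacobianMatrix f).det ≠ 0) : Function.Injective f := by
  rw [injective_iff_map_eq_zero]
  intro P
  induction hd : P.totalDegree using Nat.strong_induction_on generalizing P with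
  | _ d ih =>
    intro hP
    have hker : ∀ i, f (pderiv i P) = 0 := by
      have : (fun i => f (pderiv i P)) = 0 := by
        apply Matrix.eq_zero_of_vecMul_eq_zero hf
        ext1 j
        have := pderiv_algHom_apply f j P
        rw [hP, map_zero] at this
        exact this.symm
      exact congrFun this
    have hz : ∀ i, pderiv i P = 0 := by
      intro i
      by_contra h0
      exact h0 (ih _ (hd ▸ totalDegree_pderiv_lt i P h0) _ rfl (hker i))
    have hC := eq_C_of_pderiv_eq_zero hz
    rw [hC, ← algebraMap_eq, f.commutes] at hP
    rw [hC]
    exact hP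

lemma isAlgebraic_adjoin_of_injective {n : ℕ}
    {f : MvPolynomial (Fin n) ℂ →ₐ[ℂ] MvPolynomial (Fin n) ℂ} (hf : Function.Injective f) :
    Algebra.IsAlgebraic (Algebra.adjoin ℂ (Set.range fun i => f (X i)))
      (MvPolynomial (Fin n) ℂ) := by
  have h1 : AlgebraicIndependent ℂ (fun i => f (X i)) :=
    (MvPolynomial.algebraicIndependent_X (Fin n) ℂ).map' hf
  have h2 : IsTranscendenceBasis ℂ (fun i => f (X i)) :=
    h1.isTranscendenceBasis_of_lift_trdeg_le_of_finite (by
      rw [MvPolynomial.trdeg_of_isDomain]; simp)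
  exact h2.isAlgebraic

end Jacobian

/-! ### Clearing denominators. -/

section Clearing

variable {k L : Type*} [Field k] [Field L] [Algebra k L]

/-- As `T` is algebraic over `k(S)`, the field `k(S)(T)` is the ring `k(S)[T]`; only coefficients
contribute denominators. -/
lemma exists_mul_mem_adjoin_union {S T : Set L}
    (hT : ∀ t ∈ T, IsAlgebraic (IntermediateField.adjoin k S) t)
    (htop : IntermediateField.adjoin k (S ∪ T) = ⊤) (z : L) :
    ∃ v ∈ Algebra.adjoin k S, v ≠ 0 ∧ v * z ∈ Algebra.adjoin k (S ∪ T) := by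
  have hz : z ∈ Algebra.adjoin (IntermediateField.adjoin k S) T := by
    rw [← IntermediateField.adjoin_toSubalgebra_of_isAlgebraic hT]
    have : z ∈ (IntermediateField.adjoin (IntermediateField.adjoin k S) T).restrictScalars k := by
      rw [IntermediateField.adjoin_adjoin_left, htop]
      trivial
    exact this
  have hle : Algebra.adjoin k S ≤ Algebra.adjoin k (S ∪ T) :=
    Algebra.adjoin_mono Set.subset_union_left
  induction hz using Algebra.adjoin_induction with
  | mem t ht =>
    exact ⟨1, one_mem _, one_ne_zero, by
      rw [one_mul]; exact Algebra.subset_adjoin (Or.inr ht)⟩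
  | algebraMap c =>
    obtain ⟨a, ha, b, hb, hab⟩ := IntermediateField.mem_adjoin_iff_div.1 c.2
    have hc : algebraMap (IntermediateField.adjoin k S) L c = a / b := hab
    rw [hc]
    by_cases hb0 : b = 0
    · exact ⟨1, one_mem _, one_ne_zero, by simp [hb0]⟩
    · exact ⟨b, hb, hb0, by rw [mul_div_cancel₀ _ hb0]; exact hle ha⟩
  | add x y _ _ hx hy =>
    obtain ⟨v, hv, hv0, hvx⟩ := hx
    obtain ⟨w, hw, hw0, hwy⟩ := hy
    refine ⟨v * w, mul_mem hv hw, mul_ne_zero hv0 hw0, ?_⟩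
    rw [show v * w * (x + y) = w * (v * x) + v * (w * y) by ring]
    exact add_mem (mul_mem (hle hw) hvx) (mul_mem (hle hv) hwy)
  | mul x y _ _ hx hy =>
    obtain ⟨v, hv, hv0, hvx⟩ := hx
    obtain ⟨w, hw, hw0, hwy⟩ := hy
    refine ⟨v * w, mul_mem hv hw, mul_ne_zero hv0 hw0, ?_⟩
    rw [show v * w * (x * y) = (v * x) * (w * y) by ring]
    exact mul_mem hvx hwy

end Clearing

/-! ### The generic fibre over `ℂ(x, y)`. -/

section GenericFibre

open Polynomial IntermediateField

/-- `ℂ[x, y, z]` embedded in `ℂ(x, y)[z]`. -/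
noncomputable def toGenericFibre :
    MvPolynomial (Fin 3) ℂ →ₐ[ℂ] (FractionRing (MvPolynomial (Fin 2) ℂ))[X] :=
  (Polynomial.mapAlgHom (Algebra.algHom ℂ (MvPolynomial (Fin 2) ℂ)
      (FractionRing (MvPolynomial (Fin 2) ℂ)))).comp
    -- `finSuccEquiv` singles out variable `0`, so `z` is moved there.
    ((MvPolynomial.finSuccEquiv ℂ 2).toAlgHom.comp (MvPolynomial.rename ![1, 2, 0]))

lemma toGenericFibre_injective : Function.Injective toGenericFibre := by
  refine (Polynomial.map_injective _ (IsFractionRing.injective (MvPolynomial (Fin 2) ℂ)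
    (FractionRing (MvPolynomial (Fin 2) ℂ)))).comp
    ((MvPolynomial.finSuccEquiv ℂ 2).injective.comp (MvPolynomial.rename_injective _ ?_))
  decide

lemma toGenericFibre_X_zero : toGenericFibre (MvPolynomial.X 0) =
    Polynomial.C (algebraMap _ _ (MvPolynomial.X 0 : MvPolynomial (Fin 2) ℂ)) := by
  change Polynomial.map _ (MvPolynomial.finSuccEquiv ℂ 2 (MvPolynomial.rename ![1, 2, 0] _)) = _
  rw [MvPolynomial.rename_X]
  change Polynomial.map _ (MvPolynomial.finSuccEquiv ℂ 2 (MvPolynomial.X (Fin.succ 0))) = _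
  rw [MvPolynomial.finSuccEquiv_X_succ, Polynomial.map_C]
  rfl

lemma toGenericFibre_X_one : toGenericFibre (MvPolynomial.X 1) =
    Polynomial.C (algebraMap _ _ (MvPolynomial.X 1 : MvPolynomial (Fin 2) ℂ)) := by
  change Polynomial.map _ (MvPolynomial.finSuccEquiv ℂ 2 (MvPolynomial.rename ![1, 2, 0] _)) = _
  rw [MvPolynomial.rename_X]
  change Polynomial.map _ (MvPolynomial.finSuccEquiv ℂ 2 (MvPolynomial.X (Fin.succ 1))) = _
  rw [MvPolynomial.finSuccEquiv_X_succ, Polynomial.map_C]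
  rfl

lemma toGenericFibre_X_two : toGenericFibre (MvPolynomial.X 2) = Polynomial.X := by
  simp [toGenericFibre, MvPolynomial.finSuccEquiv_X_zero]

lemma derivative_toGenericFibre (P : MvPolynomial (Fin 3) ℂ) :
    derivative (toGenericFibre P) = toGenericFibre (MvPolynomial.pderiv 2 P) := by
  induction P using MvPolynomial.induction_on with
  | C a =>
    rw [← MvPolynomial.algebraMap_eq, toGenericFibre.commutes, MvPolynomial.algebraMap_eq]
    simp [Polynomial.algebraMap_apply]
  | add p q hp hq => simp [hp, hq]
  | mul_X p i hp =>
    have hX : derivative (toGenericFibre (MvPolynomial.X i)) =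
        toGenericFibre (MvPolynomial.pderiv 2 (MvPolynomial.X i)) := by
      fin_cases i
      · simp [toGenericFibre_X_zero, MvPolynomial.pderiv_X]
      · simp [toGenericFibre_X_one, MvPolynomial.pderiv_X]
      · simp [toGenericFibre_X_two]
    rw [map_mul, derivative_mul, hp, hX, MvPolynomial.pderiv_mul, map_add, map_mul, map_mul]

lemma isUnit_of_dvd_derivative_toGenericFibre
    {f : MvPolynomial (Fin 3) ℂ →ₐ[ℂ] MvPolynomial (Fin 3) ℂ} (hf : IsJacobianEndomorphism f)
    {d : (FractionRing (MvPolynomial (Fin 2) ℂ))[X]}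
    (hd : ∀ i, d ∣ derivative (toGenericFibre (f (MvPolynomial.X i)))) : IsUnit d := by
  obtain ⟨c, hc, hdet⟩ := hf
  have hu : IsUnit (toGenericFibre (MvPolynomial.C c)) :=
    ((isUnit_iff_ne_zero.2 hc).map MvPolynomial.C).map toGenericFibre
  refine isUnit_of_dvd_unit ?_ hu
  rw [← hdet, Matrix.det_succ_column _ 2, map_sum]
  refine Finset.dvd_sum fun i _ => ?_
  rw [map_mul, map_mul]
  refine Dvd.dvd.mul_right (Dvd.dvd.mul_left ?_ _) _
  have := hd i
  rwa [derivative_toGenericFibre] at this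

/-- `ℂ[x, y, z]` embedded in `ℂ(x, y)(z)`. -/
noncomputable def toRatFunc :
    MvPolynomial (Fin 3) ℂ →ₐ[ℂ] RatFunc (FractionRing (MvPolynomial (Fin 2) ℂ)) :=
  (Algebra.algHom ℂ (FractionRing (MvPolynomial (Fin 2) ℂ))[X] _).comp toGenericFibre

lemma toRatFunc_injective : Function.Injective toRatFunc :=
  (RatFunc.algebraMap_injective _).comp toGenericFibre_injective

lemma adjoin_toRatFunc_eq_top
    {f : MvPolynomial (Fin 3) ℂ →ₐ[ℂ] MvPolynomial (Fin 3) ℂ} (hf : IsJacobianEndomorphism f) :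
    IntermediateField.adjoin ℂ (toRatFunc '' (Set.range fun i => f (MvPolynomial.X i)) ∪
      toRatFunc '' {MvPolynomial.X 0, MvPolynomial.X 1}) = ⊤ := by
  set M := IntermediateField.adjoin ℂ (toRatFunc '' (Set.range fun i => f (MvPolynomial.X i)) ∪
    toRatFunc '' {MvPolynomial.X 0, MvPolynomial.X 1}) with hM
  have hpoly : ∀ P : MvPolynomial (Fin 2) ℂ, algebraMap (FractionRing (MvPolynomial (Fin 2) ℂ))
      (RatFunc (FractionRing (MvPolynomial (Fin 2) ℂ))) (algebraMap _ _ P) ∈ M := by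
    intro P
    induction P using MvPolynomial.induction_on with
    | C a =>
      rw [← MvPolynomial.algebraMap_eq, ← IsScalarTower.algebraMap_apply,
        ← IsScalarTower.algebraMap_apply]
      exact M.algebraMap_mem a
    | add p q hp hq => simpa only [map_add] using add_mem hp hq
    | mul_X p i hp =>
      rw [map_mul, map_mul]
      refine mul_mem hp (subset_adjoin ℂ _ (Or.inr ?_))
      fin_cases i
      · exact ⟨MvPolynomial.X 0, by simp, by
          simp only [toRatFunc, AlgHom.comp_apply, toGenericFibre_X_zero]
          exact RatFunc.algebraMap_C _⟩
      · exact ⟨MvPolynomial.X 1, by simp, by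
          simp only [toRatFunc, AlgHom.comp_apply, toGenericFibre_X_one]
          exact RatFunc.algebraMap_C _⟩
  have hconst : ∀ a, algebraMap (FractionRing (MvPolynomial (Fin 2) ℂ))
      (RatFunc (FractionRing (MvPolynomial (Fin 2) ℂ))) a ∈ M := by
    intro a
    obtain ⟨P, Q, -, rfl⟩ := IsFractionRing.div_surjective (A := MvPolynomial (Fin 2) ℂ) a
    rw [map_div₀]
    exact div_mem (hpoly P) (hpoly Q)
  -- `M` contains `ℂ(x, y)`, so it can be reread as an extension of that field.
  let N : IntermediateField (FractionRing (MvPolynomial (Fin 2) ℂ))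
      (RatFunc (FractionRing (MvPolynomial (Fin 2) ℂ))) :=
    { M.toSubfield with algebraMap_mem' := hconst }
  have hN : N = ⊤ := by
    rw [eq_top_iff, ← adjoin_image_algebraMap_eq_top_of_derivative
      (Set.range fun i => toGenericFibre (f (MvPolynomial.X i)))
      fun d hd => isUnit_of_dvd_derivative_toGenericFibre hf fun i => hd _ ⟨i, rfl⟩,
      IntermediateField.adjoin_le_iff]
    rintro _ ⟨_, ⟨i, rfl⟩, rfl⟩
    exact subset_adjoin ℂ _ (Or.inl ⟨_, ⟨i, rfl⟩, rfl⟩)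
  rw [eq_top_iff]
  intro t _
  have : t ∈ N := hN ▸ IntermediateField.mem_top
  exact this

lemma isAlgebraic_toRatFunc
    {f : MvPolynomial (Fin 3) ℂ →ₐ[ℂ] MvPolynomial (Fin 3) ℂ} (hf : IsJacobianEndomorphism f)
    (t : MvPolynomial (Fin 3) ℂ) :
    IsAlgebraic (IntermediateField.adjoin ℂ
      (toRatFunc '' (Set.range fun i => f (MvPolynomial.X i)))) (toRatFunc t) := by
  have hinj : Function.Injective f := by
    obtain ⟨c, hc, hdet⟩ := hf
    exact injective_of_det_polyJacobianMatrix_ne_zero (by simpa [hdet] using hc)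
  obtain ⟨P, hP, hPt⟩ := (isAlgebraic_adjoin_of_injective hinj).isAlgebraic t
  have hmem : ∀ a : Algebra.adjoin ℂ (Set.range fun i => f (MvPolynomial.X i)),
      toRatFunc a ∈ (IntermediateField.adjoin ℂ
        (toRatFunc '' (Set.range fun i => f (MvPolynomial.X i)))).toSubalgebra := by
    intro a
    refine IntermediateField.algebra_adjoin_le_adjoin ℂ _ ?_
    rw [← AlgHom.map_adjoin]
    exact ⟨a, a.2, rfl⟩
  let h : Algebra.adjoin ℂ (Set.range fun i => f (MvPolynomial.X i)) →ₐ[ℂ]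
      (IntermediateField.adjoin ℂ
        (toRatFunc '' (Set.range fun i => f (MvPolynomial.X i)))).toSubalgebra :=
    (toRatFunc.comp (Subalgebra.val _)).codRestrict _ hmem
  have hh : Function.Injective h := fun a b hab =>
    Subtype.ext (toRatFunc_injective (congrArg Subtype.val hab))
  refine ⟨P.map h.toRingHom, (Polynomial.map_ne_zero_iff hh).2 hP, ?_⟩
  rw [aeval_def, eval₂_map]
  have h1 := congrArg toRatFunc hPt
  rw [map_zero, aeval_def] at h1
  rw [← h1]
  exact (Polynomial.hom_eval₂ P _ toRatFunc.toRingHom t).symm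

end GenericFibre

theorem mainTheorem7
    (f : MvPolynomial (Fin 3) ℂ →ₐ[ℂ] MvPolynomial (Fin 3) ℂ)
    (hf : IsJacobianEndomorphism f)
    (x y z p q r : MvPolynomial (Fin 3) ℂ)
    (hx : x = MvPolynomial.X 0) (hy : y = MvPolynomial.X 1) (hz : z = MvPolynomial.X 2)
    (hp : p = f x) (hq : q = f y) (hr : r = f z) :
    ∃ u ∈ Algebra.adjoin ℂ ({p, q, r, x, y} : Set (MvPolynomial (Fin 3) ℂ)),
      ∃ v ∈ Algebra.adjoin ℂ ({p, q, r} : Set (MvPolynomial (Fin 3) ℂ)),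
        u ≠ 0 ∧ v ≠ 0 ∧
          algebraMap (MvPolynomial (Fin 3) ℂ) (FractionRing (MvPolynomial (Fin 3) ℂ)) z =
            algebraMap (MvPolynomial (Fin 3) ℂ) (FractionRing (MvPolynomial (Fin 3) ℂ)) u /
              algebraMap (MvPolynomial (Fin 3) ℂ) (FractionRing (MvPolynomial (Fin 3) ℂ)) v := by
  have hrange : (Set.range fun i => f (MvPolynomial.X i)) = {p, q, r} := by
    subst hp hq hr hx hy hz
    ext t
    simp [Fin.exists_fin_succ, eq_comm]
  have htop := adjoin_toRatFunc_eq_top hf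
  obtain ⟨v', hv', hv0, hu'⟩ := exists_mul_mem_adjoin_union
    (by rintro _ ⟨t, -, rfl⟩; exact isAlgebraic_toRatFunc hf t) htop (toRatFunc z)
  rw [← Set.image_union, ← AlgHom.map_adjoin] at hu'
  rw [← AlgHom.map_adjoin] at hv'
  obtain ⟨v, hv, rfl⟩ := hv'
  obtain ⟨u, hu, huv⟩ := hu'
  have hvz : u = v * z := by
    apply toRatFunc_injective
    rw [map_mul]
    exact huv
  have hv0' : v ≠ 0 := by
    rintro rfl
    exact hv0 (map_zero toRatFunc)
  have hset : ({p, q, r} : Set (MvPolynomial (Fin 3) ℂ)) ∪ {MvPolynomial.X 0, MvPolynomial.X 1} =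
      {p, q, r, x, y} := by
    rw [← hx, ← hy, Set.insert_union, Set.insert_union, Set.singleton_union]
  rw [hrange] at hv hu
  rw [hset] at hu
  refine ⟨u, hu, v, hv, ?_, hv0', ?_⟩
  · rw [hvz, hz]
    exact mul_ne_zero hv0' (MvPolynomial.X_ne_zero 2)
  · rw [hvz, map_mul, mul_div_cancel_left₀]
    exact (map_ne_zero_iff _ (IsFractionRing.injective _ _)).2 hv0'
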